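/- For a connected graph $G$ on a finite vertex set, let $d_G(u,v)$ be the distance of $u$ and $v$ and let $e_G(u)=\max_v d_G(u,v)$ be the eccentricity of $u$. The eccentricity matrix $\mathcal{E}(G)$ is the real symmetric matrix, indexed by the vertices of $G$, whose $(u,v)$ entry is $d_G(u,v)$ if $d_G(u,v)=\min\{e_G(u),e_G(v)\}$ and $0$ otherwise. Let $\xi_1(G)$ denote the largest eigenvalue of $\mathcal{E}(G)$. For $n\geq 4$, let $T_{n,3}^{0,n-4}$ be the tree on $n$ vertices obtained from a path $v_0v_1v_2v_3$ by attaching $n-4$ further pendant vertices to $v_2$. Write $G^c$ for the complement of $G$. Theorem. Let $n\geq 4$ and let $T$ be a tree on $n$ vertices whose complement $T^c$ is connected. Then $$\xi_1(T^c)\leq \xi_1\big((T_{n,3}^{0,n-4})^c\big),$$ with equality if and only if $T\cong T_{n,3}^{0,n-4}$. -/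

import Mathlib

open scoped Matrix

noncomputable section

/-- The eccentricity matrix of a graph: the `(u, v)` entry is the distance `d(u, v)` if
`d(u, v) = min (e(u), e(v))`, where `e` is the vertex eccentricity, and `0` otherwise. -/
def eccMatrix {V : Type*} (G : SimpleGraph V) : Matrix V V ℝ :=
  Matrix.of fun u v => if (G.dist u v : ℕ∞) = min (G.eccent u) (G.eccent v)
    then (G.dist u v : ℝ) else 0

theorem eccMatrix_isHermitian {V : Type*} (G : SimpleGraph V) : (eccMatrix G).IsHermitian := by
  ext u v
  simp [eccMatrix, SimpleGraph.dist_comm, min_comm]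

/-- The largest eigenvalue `ξ₁(G)` of the eccentricity matrix of `G`. -/
def xiOne {V : Type*} [Fintype V] [DecidableEq V] (G : SimpleGraph V) : ℝ :=
  sSup (spectrum ℝ (eccMatrix G))

theorem isGreatest_xiOne {V : Type*} [Fintype V] [DecidableEq V] [Nonempty V]
    (G : SimpleGraph V) : IsGreatest (spectrum ℝ (eccMatrix G)) (xiOne G) := by
  have h := (eccMatrix_isHermitian G).spectrum_real_eq_range_eigenvalues
  have hf : (spectrum ℝ (eccMatrix G)).Finite := by rw [h]; exact Set.finite_range _
  have hne : (spectrum ℝ (eccMatrix G)).Nonempty := by rw [h]; exact Set.range_nonempty _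
  exact ⟨hne.csSup_mem hf, fun x hx => le_csSup hf.bddAbove hx⟩

end

/-- The tree obtained from the path `v₀ v₁ v₂ v₃` (the vertices `Sum.inl 0, …, Sum.inl 3`) by
attaching `a` pendant vertices to `v₁` and `b` pendant vertices to `v₂`. -/
def diamThreeTree (a b : ℕ) : SimpleGraph (Fin 4 ⊕ (Fin a ⊕ Fin b)) where
  Adj x y := match x, y with
    | Sum.inl i, Sum.inl j => (SimpleGraph.pathGraph 4).Adj i j
    | Sum.inl i, Sum.inr (Sum.inl _) => i = 1
    | Sum.inr (Sum.inl _), Sum.inl i => i = 1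
    | Sum.inl i, Sum.inr (Sum.inr _) => i = 2
    | Sum.inr (Sum.inr _), Sum.inl i => i = 2
    | Sum.inr _, Sum.inr _ => False
  symm := ⟨by
    rintro (i | i | i) (j | j | j) h
    all_goals first | exact h | exact SimpleGraph.Adj.symm (G := SimpleGraph.pathGraph 4) h⟩
  loopless := ⟨by
    rintro (i | i | i) h
    all_goals first | exact h | exact (SimpleGraph.pathGraph 4).loopless.irrefl _ h⟩

/-! Everything depends on whether `T` has a dominating edge, one with no outside vertex non-adjacent
to both ends.

Without one, adjacent vertices of `T` are at distance 2 in `Tᶜ` and all eccentricities are 2, so the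
eccentricity matrix is twice the adjacency matrix of `T`. Adjacency eigenvalues of a tree satisfy `l
^ 2 ≤ n - 1`, hence `ξ₁ ^ 2 ≤ 4 (n - 1)`, strictly below the target value (`lt_largerRoot`).

With one, acyclicity makes `T` a double star with `a + b = n - 2` leaves, both numbers positive
because `Tᶜ` is connected. Then `ξ₁ ^ 2` is the larger root of `t ^ 2 - (4 n + 1) t + 16 a b`, which
decreases in `a b`; the product is least exactly when `a` or `b` is 1, which is the extremal tree.
-/

theorem Matrix.mem_spectrum_iff_exists_mulVec {V : Type*} [Fintype V] [DecidableEq V]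
    (M : Matrix V V ℝ) (μ : ℝ) : μ ∈ spectrum ℝ M ↔ ∃ x : V → ℝ, x ≠ 0 ∧ M *ᵥ x = μ • x := by
  rw [← Matrix.spectrum_toLin', ← Module.End.hasEigenvalue_iff_mem_spectrum]
  constructor
  · intro h
    obtain ⟨x, hx⟩ := h.exists_hasEigenvector
    exact ⟨x, hx.2, by simpa using hx.apply_eq_smul⟩
  · rintro ⟨x, hx0, hx⟩
    exact Module.End.hasEigenvalue_of_hasEigenvector (x := x)
      (Module.End.hasEigenvector_iff.2 ⟨by simpa [Module.End.mem_eigenspace_iff] using hx, hx0⟩)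

/-! ### Adjacency eigenvalues of a tree. -/

namespace SimpleGraph

variable {V : Type*} {G : SimpleGraph V}

theorem IsAcyclic.not_adj_of_common_neighbor (hG : G.IsAcyclic) {u v w : V} (hu : G.Adj v u)
    (hw : G.Adj v w) : ¬ G.Adj u w := by
  classical
  intro h
  exact hG.cliqueFree le_rfl {v, u, w} (is3Clique_triple_iff.2 ⟨hu, hw, h⟩)

/-- An edge incident to two different neighbours of `v` would close a triangle, so the sum counts
distinct edges. -/
theorem IsTree.sum_degree_neighborFinset_le [Fintype V] [DecidableEq V] [DecidableRel G.Adj]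
    (hG : G.IsTree) (v : V) :
    ∑ u ∈ G.neighborFinset v, G.degree u ≤ Fintype.card V - 1 := by
  rw [← hG.card_edgeFinset, Nat.add_sub_cancel]
  simp_rw [← card_incidenceFinset_eq_degree]
  rw [← Finset.card_biUnion]
  · refine Finset.card_le_card (Finset.biUnion_subset.2 fun u _ => G.incidenceFinset_subset u)
  · intro u hu w hw huw
    rw [Finset.mem_coe, mem_neighborFinset] at hu hw
    rw [Function.onFun, Finset.disjoint_left]
    intro e he he'
    rw [mem_incidenceFinset] at he he'
    exact hG.isAcyclic.not_adj_of_common_neighbor hu hw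
      (G.adj_of_mem_incidenceSet huw he he')

/-- Cauchy–Schwarz in each row, summed over all rows, leaves `x v ^ 2` with the sum of the degrees
of the neighbours of `v` as coefficient. -/
theorem IsTree.sq_le_of_mulVec_adjMatrix [Fintype V] [DecidableEq V] [DecidableRel G.Adj]
    (hG : G.IsTree) {x : V → ℝ} (hx0 : x ≠ 0) {l : ℝ} (hx : G.adjMatrix ℝ *ᵥ x = l • x) :
    l ^ 2 ≤ Fintype.card V - 1 := by
  have hpos : 0 < ∑ u, x u ^ 2 := by
    obtain ⟨u, hu⟩ := Function.ne_iff.1 hx0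
    exact Finset.sum_pos' (fun _ _ => sq_nonneg _) ⟨u, Finset.mem_univ _, by
      have : x u ≠ 0 := hu
      positivity⟩
  have hcard : 1 ≤ Fintype.card V := by
    rw [← hG.card_edgeFinset]; omega
  have h1 : ∀ u, (l * x u) ^ 2 ≤ ∑ v ∈ G.neighborFinset u, (G.degree u : ℝ) * x v ^ 2 := by
    intro u
    have := congrFun hx u
    rw [adjMatrix_mulVec_apply, Pi.smul_apply, smul_eq_mul] at this
    rw [← this, ← Finset.mul_sum, ← card_neighborFinset_eq_degree]
    exact sq_sum_le_card_mul_sum_sq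
  have h2 : ∑ u, ∑ v ∈ G.neighborFinset u, (G.degree u : ℝ) * x v ^ 2 =
      ∑ v, (∑ u ∈ G.neighborFinset v, (G.degree u : ℝ)) * x v ^ 2 := by
    simp_rw [Finset.sum_mul]
    refine Finset.sum_comm' fun u v => ?_
    simp [adj_comm]
  have h3 : ∑ v, (∑ u ∈ G.neighborFinset v, (G.degree u : ℝ)) * x v ^ 2 ≤
      ∑ v, ((Fintype.card V : ℝ) - 1) * x v ^ 2 := by
    refine Finset.sum_le_sum fun v _ => mul_le_mul_of_nonneg_right ?_ (sq_nonneg _)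
    have := hG.sum_degree_neighborFinset_le v
    have h : ((∑ u ∈ G.neighborFinset v, G.degree u : ℕ) : ℝ) ≤ ((Fintype.card V - 1 : ℕ) : ℝ) :=
      by exact_mod_cast this
    rwa [Nat.cast_sub hcard, Nat.cast_sum, Nat.cast_one] at h
  have h4 := (Finset.sum_le_sum fun u (_ : u ∈ Finset.univ) => h1 u).trans (h2.le.trans h3)
  simp_rw [mul_pow, ← Finset.mul_sum] at h4
  exact le_of_mul_le_mul_right h4 hpos

/-! ### Distances and the eccentricity matrix in a complement. -/

theorem two_le_edist_compl {u v : V} (h : G.Adj u v) : 2 ≤ Gᶜ.edist u v := by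
  have : ¬ Gᶜ.edist u v ≤ 1 := by
    rw [edist_le_one_iff_adj_or_eq]
    simp [h, h.ne]
  exact Order.add_one_le_of_lt (not_le.1 this)

theorem edist_compl_of_not_adj {u v : V} (hne : u ≠ v) (h : ¬ G.Adj u v) : Gᶜ.edist u v = 1 := by
  rw [edist_eq_one_iff_adj]
  exact ⟨hne, h⟩

theorem edist_compl_eq_two {u v w : V} (h : G.Adj u v) (hu : w ≠ u) (hv : w ≠ v)
    (hwu : ¬ G.Adj u w) (hwv : ¬ G.Adj w v) : Gᶜ.edist u v = 2 := by
  refine le_antisymm ?_ (two_le_edist_compl h)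
  refine (SimpleGraph.edist_triangle (v := w)).trans ?_
  rw [edist_compl_of_not_adj hu.symm hwu, edist_compl_of_not_adj hv hwv, one_add_one_eq_two]

theorem eccMatrix_apply_of_edist {u v : V} {k : ℕ} (h : G.edist u v = k) :
    eccMatrix G u v = if (k : ℕ∞) = min (G.eccent u) (G.eccent v) then (k : ℝ) else 0 := by
  simp [eccMatrix, SimpleGraph.dist, h]

theorem two_le_eccent_compl {u v : V} (h : G.Adj u v) : 2 ≤ Gᶜ.eccent u :=
  (two_le_edist_compl h).trans edist_le_eccent

/-- The distance in the complement is at most 1, while a neighbour in `G` forces every eccentricity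
there to be at least 2. -/
theorem eccMatrix_compl_of_not_adj (hN : ∀ u, ∃ v, G.Adj u v) {u v : V} (h : ¬ G.Adj u v) :
    eccMatrix Gᶜ u v = 0 := by
  obtain rfl | hne := eq_or_ne u v
  · rw [eccMatrix_apply_of_edist (k := 0) (by simp)]; simp
  · rw [eccMatrix_apply_of_edist (k := 1) (by simp [edist_compl_of_not_adj hne h]), if_neg]
    obtain ⟨u', hu⟩ := hN u
    obtain ⟨v', hv⟩ := hN v
    have := le_min (two_le_eccent_compl hu) (two_le_eccent_compl hv)
    intro h1
    rw [← h1] at this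
    exact absurd this (by norm_num)

theorem eccMatrix_compl_eq_smul_adjMatrix [DecidableRel G.Adj] (hN : ∀ u, ∃ v, G.Adj u v)
    (hdom : ∀ u v, G.Adj u v → ∃ w, w ≠ u ∧ w ≠ v ∧ ¬ G.Adj u w ∧ ¬ G.Adj w v) :
    eccMatrix Gᶜ = (2 : ℝ) • G.adjMatrix ℝ := by
  have hd : ∀ u v, G.Adj u v → Gᶜ.edist u v = 2 := fun u v h => by
    obtain ⟨w, h1, h2, h3, h4⟩ := hdom u v h
    exact edist_compl_eq_two h h1 h2 h3 h4
  have he : ∀ u, Gᶜ.eccent u = 2 := by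
    intro u
    obtain ⟨v, hv⟩ := hN u
    refine le_antisymm ((eccent_le_iff _ _).2 fun w => ?_) (two_le_eccent_compl hv)
    by_cases h : G.Adj u w
    · exact (hd u w h).le
    · refine le_trans ?_ one_le_two
      rw [edist_le_one_iff_adj_or_eq, compl_adj]
      tauto
  ext u v
  by_cases h : G.Adj u v
  · rw [eccMatrix_apply_of_edist (k := 2) (by simp [hd u v h])]
    simp [he, h]
  · simp [eccMatrix_compl_of_not_adj hN h, h]

end SimpleGraph

/-! ### Double stars and the spectrum of their complements. -/

namespace SimpleGraph

variable {V : Type*} {G : SimpleGraph V}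

/-- `G` is a double star: `s` tells the side of a vertex, `c i` is the center of side `i`, the other
vertices of a side are joined to its center only, and the two centers are adjacent. -/
structure IsDoubleStar (G : SimpleGraph V) (s : V → Bool) (c : Bool → V) : Prop where
  side_center : ∀ i, s (c i) = i
  adj_iff : ∀ u v, G.Adj u v ↔ u ≠ v ∧ ((s u = s v ∧ (u = c (s u) ∨ v = c (s v))) ∨
    (s u ≠ s v ∧ u = c (s u) ∧ v = c (s v)))

/-- The vertices of side `i` other than the center. -/
def sideLeaves [Fintype V] [DecidableEq V] (s : V → Bool) (c : Bool → V) (i : Bool) : Finset V :=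
  Finset.univ.filter fun w => s w = i ∧ w ≠ c i

theorem mem_sideLeaves [Fintype V] [DecidableEq V] {s : V → Bool} {c : Bool → V} {i : Bool}
    {w : V} : w ∈ sideLeaves s c i ↔ s w = i ∧ w ≠ c i := by
  simp [sideLeaves]

namespace IsDoubleStar

variable {s : V → Bool} {c : Bool → V}

theorem adj_leaf_iff (h : G.IsDoubleStar s c) {w : V} (hw : w ≠ c (s w)) (v : V) :
    G.Adj w v ↔ v = c (s w) := by
  rw [h.adj_iff]
  constructor
  · rintro ⟨-, ⟨h1, h2 | h2⟩ | ⟨-, h2, -⟩⟩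
    · exact absurd h2 hw
    · rw [h2, h1]
    · exact absurd h2 hw
  · rintro rfl
    exact ⟨hw, Or.inl (by simp [h.side_center])⟩

theorem center_ne (h : G.IsDoubleStar s c) (i : Bool) : c i ≠ c (!i) := fun e => by
  have := congrArg s e
  simp [h.side_center] at this

theorem adj_center_iff (h : G.IsDoubleStar s c) (i : Bool) (v : V) :
    G.Adj (c i) v ↔ v = c (!i) ∨ (s v = i ∧ v ≠ c i) := by
  rw [h.adj_iff, h.side_center]
  constructor
  · rintro ⟨h0, ⟨h1, -⟩ | ⟨h1, -, h3⟩⟩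
    · exact Or.inr ⟨h1.symm, h0.symm⟩
    · left
      rw [h3]
      congr 1
      revert h1; cases i <;> cases s v <;> simp
  · rintro (rfl | ⟨h1, h2⟩)
    · exact ⟨h.center_ne i, Or.inr (by simp [h.side_center])⟩
    · exact ⟨h2.symm, Or.inl ⟨h1.symm, Or.inl rfl⟩⟩

theorem exists_adj (h : G.IsDoubleStar s c) (u : V) : ∃ v, G.Adj u v := by
  by_cases hu : u = c (s u)
  · exact ⟨c (!(s u)), by rw [hu, h.adj_center_iff, h.side_center]; exact Or.inl rfl⟩
  · exact ⟨c (s u), by rw [h.adj_leaf_iff hu]⟩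

variable [Fintype V] [DecidableEq V]

/-- A leaf of the other side is non-adjacent to both vertices. -/
theorem edist_leaf_center (h : G.IsDoubleStar s c) (hne : ∀ i, (sideLeaves s c i).Nonempty)
    {w : V} (hw : w ≠ c (s w)) : Gᶜ.edist w (c (s w)) = 2 := by
  obtain ⟨l, hl⟩ := hne (!(s w))
  rw [mem_sideLeaves] at hl
  have hls : s w ≠ s l := by rw [hl.1]; simp
  have h1 : c (!(s w)) ≠ c (s w) := (h.center_ne _).symm
  refine edist_compl_eq_two (w := l) ((h.adj_leaf_iff hw _).2 rfl) ?_ ?_ ?_ ?_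
  · rintro rfl; exact hls rfl
  · rintro rfl; rw [h.side_center] at hls; exact hls rfl
  · rw [h.adj_leaf_iff hw]; rintro rfl; rw [h.side_center] at hls; exact hls rfl
  · rw [h.adj_leaf_iff (by rw [hl.1]; exact hl.2), hl.1]
    exact h1.symm

theorem eccent_leaf (h : G.IsDoubleStar s c) (hne : ∀ i, (sideLeaves s c i).Nonempty)
    {w : V} (hw : w ≠ c (s w)) : Gᶜ.eccent w = 2 := by
  refine le_antisymm ((eccent_le_iff _ _).2 fun v => ?_)
    (two_le_eccent_compl ((h.adj_leaf_iff hw _).2 rfl))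
  by_cases hv : v = c (s w)
  · rw [hv, h.edist_leaf_center hne hw]
  · refine le_trans ?_ one_le_two
    rw [edist_le_one_iff_adj_or_eq, compl_adj, h.adj_leaf_iff hw]
    tauto

/-- Every vertex is adjacent in `G` to one of the centers, so they have no common neighbour in the
complement; a leaf of side `i` gives a route of length 2 + 1. -/
theorem edist_center (h : G.IsDoubleStar s c) (hne : ∀ i, (sideLeaves s c i).Nonempty)
    (i : Bool) : Gᶜ.edist (c i) (c (!i)) = 3 := by
  refine le_antisymm ?_ ?_
  · obtain ⟨l, hl⟩ := hne i
    rw [mem_sideLeaves] at hl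
    have hl' : l ≠ c (s l) := by rw [hl.1]; exact hl.2
    have h2 := h.edist_leaf_center hne hl'
    rw [hl.1, edist_comm] at h2
    refine (SimpleGraph.edist_triangle (v := l)).trans ?_
    rw [h2, edist_compl_of_not_adj]
    · norm_num
    · rintro rfl; rw [h.side_center] at hl; simp at hl
    · rw [h.adj_leaf_iff hl', hl.1]; exact (h.center_ne i).symm
  · have : 2 < Gᶜ.edist (c i) (c (!i)) := by
      rw [two_lt_edist_iff]
      refine ⟨h.center_ne i, by simp [h.adj_center_iff], ?_⟩
      ext w
      simp only [mem_commonNeighbors, compl_adj, h.adj_center_iff, Set.mem_empty_iff_false,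
        iff_false, Bool.not_not]
      rintro ⟨⟨h1, h2⟩, h3, h4⟩
      have : s w = i ∨ s w = !i := by cases s w <;> cases i <;> simp
      have := h1.symm
      have := h3.symm
      tauto
    exact Order.add_one_le_of_lt this

theorem eccent_center (h : G.IsDoubleStar s c) (hne : ∀ i, (sideLeaves s c i).Nonempty)
    (i : Bool) : Gᶜ.eccent (c i) = 3 := by
  refine le_antisymm ((eccent_le_iff _ _).2 fun v => ?_)
    ((h.edist_center hne i).symm.le.trans edist_le_eccent)
  by_cases hv : v = c (!i)
  · rw [hv, h.edist_center hne]
  by_cases hv' : G.Adj (c i) v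
  · have h1 := ((h.adj_center_iff _ _).1 hv').resolve_left hv
    have h2 := h.edist_leaf_center hne (w := v) (by rw [h1.1]; exact h1.2)
    rw [h1.1, edist_comm] at h2
    rw [h2]; norm_num
  · refine le_trans ?_ (show (1 : ℕ∞) ≤ 3 by norm_num)
    rw [edist_le_one_iff_adj_or_eq, compl_adj]
    tauto

theorem eccMatrix_leaf (h : G.IsDoubleStar s c) (hne : ∀ i, (sideLeaves s c i).Nonempty)
    {w : V} (hw : w ≠ c (s w)) (v : V) :
    eccMatrix Gᶜ w v = if v = c (s w) then 2 else 0 := by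
  split_ifs with hv
  · subst hv
    rw [eccMatrix_apply_of_edist (k := 2) (h.edist_leaf_center hne hw), h.eccent_leaf hne hw,
      h.eccent_center hne, if_pos] <;> norm_num
  · exact eccMatrix_compl_of_not_adj h.exists_adj (by rwa [h.adj_leaf_iff hw])

theorem eccMatrix_center (h : G.IsDoubleStar s c) (hne : ∀ i, (sideLeaves s c i).Nonempty)
    (i : Bool) (v : V) :
    eccMatrix Gᶜ (c i) v =
      (if v = c (!i) then 3 else 0) + if v ∈ sideLeaves s c i then 2 else 0 := by
  by_cases hv : v = c (!i)
  · subst hv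
    rw [eccMatrix_apply_of_edist (k := 3) (h.edist_center hne i), h.eccent_center hne,
      h.eccent_center hne, if_pos (by simp)]
    simp [mem_sideLeaves, h.side_center]
  by_cases hv' : v ∈ sideLeaves s c i
  · rw [if_neg hv, if_pos hv', zero_add]
    rw [mem_sideLeaves] at hv'
    have hl : v ≠ c (s v) := by rw [hv'.1]; exact hv'.2
    rw [← (eccMatrix_isHermitian Gᶜ).apply, h.eccMatrix_leaf hne hl,
      if_pos (by rw [hv'.1])]
    simp
  · rw [if_neg hv, if_neg hv', add_zero]
    rw [mem_sideLeaves] at hv'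
    exact eccMatrix_compl_of_not_adj h.exists_adj (by rw [h.adj_center_iff]; tauto)

theorem mulVec_leaf (h : G.IsDoubleStar s c) (hne : ∀ i, (sideLeaves s c i).Nonempty)
    (x : V → ℝ) {w : V} (hw : w ≠ c (s w)) : (eccMatrix Gᶜ *ᵥ x) w = 2 * x (c (s w)) := by
  simp [Matrix.mulVec, dotProduct, h.eccMatrix_leaf hne hw, ite_mul]

theorem mulVec_center (h : G.IsDoubleStar s c) (hne : ∀ i, (sideLeaves s c i).Nonempty)
    (x : V → ℝ) (i : Bool) :
    (eccMatrix Gᶜ *ᵥ x) (c i) = 3 * x (c (!i)) + 2 * ∑ w ∈ sideLeaves s c i, x w := by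
  simp [Matrix.mulVec, dotProduct, h.eccMatrix_center hne, ite_mul, add_mul,
    Finset.sum_add_distrib, Finset.mul_sum]

/-- Eliminating the leaves by `μ * x w = 2 * x (c i)` leaves a 2 × 2 system in the two center
values; the equation is the vanishing of its determinant. -/
theorem mem_spectrum_iff (h : G.IsDoubleStar s c) (hne : ∀ i, (sideLeaves s c i).Nonempty)
    {μ : ℝ} (hμ : 0 < μ) : μ ∈ spectrum ℝ (eccMatrix Gᶜ) ↔
      (μ ^ 2 - 4 * (sideLeaves s c true).card) * (μ ^ 2 - 4 * (sideLeaves s c false).card)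
        = 9 * μ ^ 2 := by
  rw [Matrix.mem_spectrum_iff_exists_mulVec]
  constructor
  · rintro ⟨x, hx0, hx⟩
    have hl : ∀ w, w ≠ c (s w) → 2 * x (c (s w)) = μ * x w := fun w hw => by
      rw [← h.mulVec_leaf hne x hw, hx]; rfl
    have hc : ∀ i, (μ ^ 2 - 4 * (sideLeaves s c i).card) * x (c i) = 3 * μ * x (c (!i)) := by
      intro i
      have h1 : μ * x (c i) = _ := (congrFun hx (c i)).symm.trans (h.mulVec_center hne x i)
      have h2 : μ * ∑ w ∈ sideLeaves s c i, x w = (sideLeaves s c i).card * (2 * x (c i)) := by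
        rw [Finset.mul_sum, ← nsmul_eq_mul, ← Finset.sum_const]
        refine Finset.sum_congr rfl fun w hw => ?_
        rw [mem_sideLeaves] at hw
        rw [← hl w (by rw [hw.1]; exact hw.2), hw.1]
      linear_combination μ * h1 + 2 * h2
    have ht := hc true
    have hf := hc false
    simp only [Bool.not_true, Bool.not_false] at ht hf
    by_cases h0 : x (c true) = 0
    · by_cases h1 : x (c false) = 0
      · refine absurd (funext fun w => ?_) hx0
        have hall : ∀ i, x (c i) = 0 := by rintro (_ | _) <;> assumption
        by_cases hw : w = c (s w)
        · rw [hw]; exact hall _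
        · have := hl w hw
          rw [hall, mul_zero] at this
          exact (mul_eq_zero.1 this.symm).resolve_left hμ.ne'
      · refine mul_right_cancel₀ h1 ?_
        linear_combination (μ ^ 2 - 4 * ((sideLeaves s c true).card : ℝ)) * hf + 3 * μ * ht
    · refine mul_right_cancel₀ h0 ?_
      linear_combination (μ ^ 2 - 4 * ((sideLeaves s c false).card : ℝ)) * ht + 3 * μ * hf
  · intro hq
    -- These center values solve the reduced equation at `c true` identically; the one at `c false`
    -- is then `hq`.
    let y : Bool → ℝ := fun i => bif i then 3 * μ else μ ^ 2 - 4 * (sideLeaves s c true).card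
    let x : V → ℝ := fun w => if w = c (s w) then y (s w) else 2 * y (s w) / μ
    have hxc : ∀ i, x (c i) = y i := fun i => by simp [x, h.side_center]
    refine ⟨x, fun h0 => ?_, funext fun w => ?_⟩
    · have := hxc true
      rw [h0] at this
      simp [y, hμ.ne'] at this
    rw [Pi.smul_apply, smul_eq_mul]
    by_cases hw : w = c (s w)
    · have hs : ∀ i, 2 * ∑ w ∈ sideLeaves s c i, x w = 4 * (sideLeaves s c i).card * y i / μ := by
        intro i
        rw [Finset.sum_congr rfl (g := fun _ => 2 * y i / μ)]
        · rw [Finset.sum_const, nsmul_eq_mul]; ring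
        · intro w hw
          rw [mem_sideLeaves] at hw
          simp [x, hw.1, hw.2]
      rw [hw, h.mulVec_center hne, hs, hxc, hxc]
      cases s w
      · simp only [y, Bool.not_false, cond_true, cond_false]
        field_simp
        linear_combination -hq
      · simp only [y, Bool.not_true, cond_true, cond_false]
        field_simp
        ring
    · rw [h.mulVec_leaf hne x hw, hxc]
      simp only [x, if_neg hw]
      field_simp

theorem card_side (h : G.IsDoubleStar s c) (i : Bool) :
    Fintype.card {v // s v = i} = (sideLeaves s c i).card + 1 := by
  rw [Fintype.card_subtype, ← Finset.card_erase_add_one (a := c i)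
    (s := Finset.univ.filter fun w => s w = i) (by simp [h.side_center])]
  congr 2
  ext w
  simp [mem_sideLeaves, and_comm]

theorem card_eq (h : G.IsDoubleStar s c) :
    Fintype.card V = (sideLeaves s c true).card + (sideLeaves s c false).card + 2 := by
  have h2 := Finset.card_filter_add_card_filter_not (s := (Finset.univ : Finset V))
    (fun w => s w = true)
  simp only [Bool.not_eq_true] at h2
  rw [← Fintype.card_subtype, ← Fintype.card_subtype, h.card_side, h.card_side,
    Finset.card_univ] at h2
  omega

end IsDoubleStar

/-- The larger root of `t ^ 2 - (4 * n + 1) * t + 16 * p`. -/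
noncomputable def largerRoot (n p : ℕ) : ℝ :=
  ((4 * n + 1) + √((4 * n + 1) ^ 2 - 64 * p)) / 2

theorem IsDoubleStar.xiOne_compl [Fintype V] [DecidableEq V] {s : V → Bool} {c : Bool → V}
    (h : G.IsDoubleStar s c) (hne : ∀ i, (sideLeaves s c i).Nonempty) :
    xiOne Gᶜ = √(largerRoot (Fintype.card V)
      ((sideLeaves s c true).card * (sideLeaves s c false).card)) := by
  have : Nonempty V := ⟨c true⟩
  set a := (sideLeaves s c true).card
  set b := (sideLeaves s c false).card
  have hn : (Fintype.card V : ℝ) = a + b + 2 := by exact_mod_cast h.card_eq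
  have hD : 0 ≤ (4 * (Fintype.card V : ℝ) + 1) ^ 2 - 64 * (a * b : ℕ) := by
    rw [hn]; push_cast
    nlinarith [sq_nonneg ((a : ℝ) - b), (Nat.cast_nonneg a : (0 : ℝ) ≤ a),
      (Nat.cast_nonneg b : (0 : ℝ) ≤ b)]
  have hS := Real.sq_sqrt hD
  have hS0 := Real.sqrt_nonneg ((4 * (Fintype.card V : ℝ) + 1) ^ 2 - 64 * (a * b : ℕ))
  have hL : 0 < largerRoot (Fintype.card V) (a * b) := by unfold largerRoot; positivity
  refine (isGreatest_xiOne Gᶜ).unique ⟨?_, fun μ hμ => ?_⟩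
  · rw [h.mem_spectrum_iff hne (Real.sqrt_pos.2 hL), Real.sq_sqrt hL.le]
    unfold largerRoot
    generalize √((4 * (Fintype.card V : ℝ) + 1) ^ 2 - 64 * (a * b : ℕ)) = S at *
    push_cast at hS
    rw [hn] at hS ⊢
    linear_combination hS / 4
  · rcases le_or_gt μ 0 with h0 | h0
    · exact h0.trans (Real.sqrt_nonneg _)
    rw [h.mem_spectrum_iff hne h0] at hμ
    refine Real.le_sqrt_of_sq_le ?_
    unfold largerRoot
    generalize √((4 * (Fintype.card V : ℝ) + 1) ^ 2 - 64 * (a * b : ℕ)) = S at *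
    push_cast at hS
    rw [hn] at hS ⊢
    -- Completing the square in the quadratic for `μ ^ 2`.
    have : (2 * μ ^ 2 - (4 * (a + b + 2) + 1)) ^ 2 = S ^ 2 := by
      rw [hS]; linear_combination 4 * hμ
    linarith [abs_le_of_sq_le_sq' this.le hS0]

end SimpleGraph

/-! ### Comparison of roots; recognizing double stars up to isomorphism. -/

namespace SimpleGraph

variable {V W : Type*} {G : SimpleGraph V} {H : SimpleGraph W}

/-- `hq` is AM–GM for `q = a * b`, `a + b = n - 2`; it keeps the discriminant nonnegative, where the
square root is strictly monotone. -/
theorem largerRoot_lt_largerRoot {n p q : ℕ} (hpq : p < q) (hq : 4 * q ≤ (n - 2) ^ 2) :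
    largerRoot n q < largerRoot n p := by
  have h0 : ((4 * q : ℕ) : ℝ) ≤ ((n ^ 2 : ℕ) : ℝ) := by
    exact_mod_cast hq.trans (Nat.pow_le_pow_left (Nat.sub_le n 2) 2)
  have h1 : (p : ℝ) < q := by exact_mod_cast hpq
  have h2 : (0 : ℝ) ≤ n := Nat.cast_nonneg n
  push_cast at h0
  unfold largerRoot
  have := Real.sqrt_lt_sqrt (x := (4 * (n : ℝ) + 1) ^ 2 - 64 * q)
    (y := (4 * (n : ℝ) + 1) ^ 2 - 64 * p) (by nlinarith) (by linarith)
  linarith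

theorem lt_largerRoot {n : ℕ} (hn : 4 ≤ n) : 4 * ((n : ℝ) - 1) < largerRoot n (n - 3) := by
  have hn' : (4 : ℝ) ≤ n := by exact_mod_cast hn
  unfold largerRoot
  rw [Nat.cast_sub (by omega)]
  have : 4 * (n : ℝ) - 9 < √((4 * (n : ℝ) + 1) ^ 2 - 64 * (n - (3 : ℕ))) := by
    apply Real.lt_sqrt_of_sq_lt
    push_cast
    nlinarith
  push_cast at this ⊢
  linarith

theorem IsDoubleStar.comap {s : W → Bool} {c : Bool → W} (h : H.IsDoubleStar s c) (e : G ≃g H) :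
    G.IsDoubleStar (s ∘ e) (e.symm ∘ c) where
  side_center i := by simp [h.side_center]
  adj_iff u v := by
    rw [← e.map_adj_iff, h.adj_iff]
    simp only [Function.comp_apply, ne_eq, EmbeddingLike.apply_eq_iff_eq]
    have : ∀ u j, u = e.symm (c j) ↔ e u = c j := fun u j => by
      constructor
      · rintro rfl; simp
      · intro h; rw [← h]; simp
    simp only [this]

theorem card_sideLeaves_comap [Fintype V] [DecidableEq V] [Fintype W] [DecidableEq W]
    (s : W → Bool) (c : Bool → W) (e : G ≃g H) (i : Bool) :
    (sideLeaves (s ∘ e) (e.symm ∘ c) i).card = (sideLeaves s c i).card := by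
  refine Finset.card_bij (fun w _ => e w) ?_ ?_ ?_
  · intro w hw
    rw [mem_sideLeaves] at hw ⊢
    refine ⟨hw.1, fun h => hw.2 ?_⟩
    simp [← h]
  · intro a _ b _ h
    exact e.injective h
  · intro w hw
    rw [mem_sideLeaves] at hw
    refine ⟨e.symm w, ?_, by simp⟩
    rw [mem_sideLeaves]
    simpa using hw

theorem IsDoubleStar.swap {s : V → Bool} {c : Bool → V} (h : G.IsDoubleStar s c) :
    G.IsDoubleStar (fun v => !(s v)) (fun i => c (!i)) where
  side_center i := by simp [h.side_center]
  adj_iff u v := by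
    rw [h.adj_iff]
    simp

theorem sideLeaves_swap [Fintype V] [DecidableEq V] (s : V → Bool) (c : Bool → V) (i : Bool) :
    sideLeaves (fun v => !(s v)) (fun i => c (!i)) i = sideLeaves s c (!i) := by
  ext w
  simp only [mem_sideLeaves]
  cases i <;> simp

theorem IsDoubleStar.nonempty_iso [Fintype V] [DecidableEq V] [Fintype W] [DecidableEq W]
    {s : V → Bool} {c : Bool → V} (h : G.IsDoubleStar s c)
    {t : W → Bool} {d : Bool → W} (h' : H.IsDoubleStar t d)
    (hcard : ∀ i, (sideLeaves s c i).card = (sideLeaves t d i).card) : Nonempty (G ≃g H) := by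
  have hfib : ∀ i, ∃ e : {v // s v = i} ≃ {w // t w = i},
      e ⟨c i, h.side_center i⟩ = ⟨d i, h'.side_center i⟩ := by
    intro i
    obtain ⟨e⟩ := Fintype.card_eq.1 ((h.card_side i).trans
      ((congrArg (· + 1) (hcard i)).trans (h'.card_side i).symm))
    -- The swap corrects an arbitrary bijection of sides so that it matches the centers.
    exact ⟨e.trans (Equiv.swap (e ⟨c i, h.side_center i⟩) ⟨d i, h'.side_center i⟩), by simp⟩
  choose e he using hfib
  let f : V ≃ W := Equiv.ofFiberEquiv e
  have hf : ∀ v, t (f v) = s v := Equiv.ofFiberEquiv_map e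
  have hfc : ∀ i, f (c i) = d i := by
    intro i
    have h1 : f (c i) = (e (s (c i)) ⟨c i, rfl⟩ : W) := rfl
    have h2 : ∀ j (hj : s (c i) = j), (e j ⟨c i, hj⟩ : W) = (e (s (c i)) ⟨c i, rfl⟩ : W) := by
      rintro j rfl; rfl
    rw [h1, ← h2 i (h.side_center i), he]
  refine ⟨f, fun {u v} => ?_⟩
  rw [h.adj_iff, h'.adj_iff]
  simp only [hf, ← hfc, ne_eq, EmbeddingLike.apply_eq_iff_eq]

theorem IsAcyclic.not_adj_of_path_three (hG : G.IsAcyclic) {u c d v : V} (huc : G.Adj u c)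
    (hcd : G.Adj c d) (hdv : G.Adj d v) (hud : u ≠ d) (hcv : c ≠ v) : ¬ G.Adj u v := by
  intro h
  have hp : (Walk.cons huc (.cons hcd (.cons hdv .nil))).IsPath := by
    simp [Walk.cons_isPath_iff, huc.ne, hcd.ne, hdv.ne, hud, hcv, h.ne]
  have hq : (Walk.cons h .nil).IsPath := by simp [h.ne]
  have := congrArg (fun p : G.Path u v => p.1.length) ((hG.subsingleton_path u v).elim ⟨_, hp⟩ ⟨_, hq⟩)
  simp at this

-- Each remaining vertex hangs on exactly one end of the dominating edge. An extra edge would close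
-- a triangle within a side or a 4-cycle across sides.
open Classical in
theorem IsAcyclic.isDoubleStar (hG : G.IsAcyclic) {c d : V} (hcd : G.Adj c d)
    (hdom : ∀ w, w ≠ c → w ≠ d → G.Adj c w ∨ G.Adj w d) :
    G.IsDoubleStar (fun w => decide (w = c ∨ (w ≠ d ∧ G.Adj c w))) (fun i => bif i then c else d)
    where
  side_center i := by cases i <;> simp [hcd.ne']
  adj_iff u v := by
    have hdc := hcd.symm
    have hne := hcd.ne
    have hside : ∀ w, w = c ∨ w = d ∨ (w ≠ c ∧ w ≠ d ∧ G.Adj c w ∧ ¬ G.Adj d w) ∨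
        (w ≠ c ∧ w ≠ d ∧ ¬ G.Adj c w ∧ G.Adj d w) := by
      intro w
      have h1 := hdom w
      have h2 : G.Adj c w → ¬ G.Adj d w := fun h => hG.not_adj_of_common_neighbor hcd h
      have h3 := G.adj_comm d w
      tauto
    have hcc : G.Adj c u → G.Adj c v → ¬ G.Adj u v := hG.not_adj_of_common_neighbor
    have hdd : G.Adj d u → G.Adj d v → ¬ G.Adj u v := hG.not_adj_of_common_neighbor
    have h1 : G.Adj c u → G.Adj d v → u ≠ d → v ≠ c → ¬ G.Adj u v := fun a b x y =>
      hG.not_adj_of_path_three a.symm hcd b x y.symm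
    have h2 : G.Adj d u → G.Adj c v → u ≠ c → v ≠ d → ¬ G.Adj u v := fun a b x y =>
      hG.not_adj_of_path_three a.symm hdc b x y.symm
    have hsu := G.adj_comm u c
    have hsv := G.adj_comm u d
    rcases hside u with rfl | rfl | ⟨a1, a2, a3, a4⟩ | ⟨a1, a2, a3, a4⟩ <;>
    rcases hside v with rfl | rfl | ⟨b1, b2, b3, b4⟩ | ⟨b1, b2, b3, b4⟩ <;>
    simp_all [eq_comm]

/-- If side `i` had no leaf, the opposite center would be adjacent to all other vertices, hence
isolated in the complement. -/
theorem IsDoubleStar.sideLeaves_nonempty [Fintype V] [DecidableEq V] {s : V → Bool} {c : Bool → V}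
    (h : G.IsDoubleStar s c) (hc : Gᶜ.Connected) (i : Bool) : (sideLeaves s c i).Nonempty := by
  by_contra hi
  have hside : ∀ w, s w = i → w = c i := fun w hw => by
    by_contra hne
    exact hi ⟨w, mem_sideLeaves.2 ⟨hw, hne⟩⟩
  have : Nontrivial V := ⟨c i, c (!i), h.center_ne i⟩
  obtain ⟨w, hw⟩ := hc.preconnected.exists_adj_of_nontrivial (c (!i))
  rw [compl_adj, h.adj_center_iff, Bool.not_not] at hw
  have h1 := hside w
  have h2 : s w = i ∨ s w = !i := by cases s w <;> cases i <;> simp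
  have := hw.1.symm
  tauto

end SimpleGraph

/-! ### The extremal tree and the final comparison. -/

open SimpleGraph

theorem diamThreeTree_isDoubleStar (a b : ℕ) : (diamThreeTree a b).IsDoubleStar
    (Sum.elim ![true, true, false, false] (Sum.elim (fun _ => true) fun _ => false))
    (fun i => Sum.inl (bif i then 1 else 2)) where
  side_center i := by cases i <;> rfl
  adj_iff := by
    rintro (i | i | i) (j | j | j)
    · fin_cases i <;> fin_cases j <;> simp [diamThreeTree, pathGraph_adj]
    · fin_cases i <;> simp [diamThreeTree]
    · fin_cases i <;> simp [diamThreeTree]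
    · fin_cases j <;> simp [diamThreeTree]
    · simp [diamThreeTree]
    · simp [diamThreeTree]
    · fin_cases j <;> simp [diamThreeTree]
    · simp [diamThreeTree]
    · simp [diamThreeTree]

/-- The extra 1 is the path end `v₀` or `v₃`. -/
theorem card_sideLeaves_diamThreeTree (a b : ℕ) (i : Bool) : (sideLeaves
    (Sum.elim ![true, true, false, false] (Sum.elim (fun _ : Fin a => true) fun _ : Fin b => false))
    (fun i => Sum.inl (bif i then 1 else 2)) i).card = (bif i then a else b) + 1 := by
  cases i
  · have : sideLeaves (Sum.elim ![true, true, false, false]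
      (Sum.elim (fun _ : Fin a => true) fun _ : Fin b => false))
      (fun i => Sum.inl (bif i then 1 else 2)) false =
      insert (Sum.inl 3) (Finset.univ.map
        (Function.Embedding.inr.trans Function.Embedding.inr)) := by
      ext (w | w | w)
      · fin_cases w <;> simp [mem_sideLeaves]
      · simp [mem_sideLeaves]
      · simp [mem_sideLeaves]
    rw [this, Finset.card_insert_of_notMem (by simp)]
    simp
  · have : sideLeaves (Sum.elim ![true, true, false, false]
      (Sum.elim (fun _ : Fin a => true) fun _ : Fin b => false))
      (fun i => Sum.inl (bif i then 1 else 2)) true =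
      insert (Sum.inl 0) (Finset.univ.map
        (Function.Embedding.inl.trans Function.Embedding.inr)) := by
      ext (w | w | w)
      · fin_cases w <;> simp [mem_sideLeaves]
      · simp [mem_sideLeaves]
      · simp [mem_sideLeaves]
    rw [this, Finset.card_insert_of_notMem (by simp)]
    simp

theorem xiOne_compl_diamThreeTree {n : ℕ} (hn : 4 ≤ n) :
    xiOne (diamThreeTree 0 (n - 4))ᶜ = √(largerRoot n (n - 3)) := by
  rw [(diamThreeTree_isDoubleStar 0 (n - 4)).xiOne_compl fun i => Finset.card_pos.1 (by
    rw [card_sideLeaves_diamThreeTree]; omega)]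
  rw [card_sideLeaves_diamThreeTree, card_sideLeaves_diamThreeTree]
  congr 2
  · simp; omega
  · simp; omega

theorem xiOne_compl_lt_of_forall_adj {V : Type*} [Fintype V] [DecidableEq V] {n : ℕ} (hn : 4 ≤ n)
    (hV : Fintype.card V = n) {T : SimpleGraph V} (hT : T.IsTree)
    (hdom : ∀ u v, T.Adj u v → ∃ w, w ≠ u ∧ w ≠ v ∧ ¬ T.Adj u w ∧ ¬ T.Adj w v) :
    xiOne Tᶜ < √(largerRoot n (n - 3)) := by
  classical
  have hnt : Nontrivial V := Fintype.one_lt_card_iff_nontrivial.1 (by omega)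
  have hmem := (isGreatest_xiOne Tᶜ).1
  rw [eccMatrix_compl_eq_smul_adjMatrix hT.connected.preconnected.exists_adj_of_nontrivial hdom,
    Matrix.mem_spectrum_iff_exists_mulVec] at hmem
  obtain ⟨x, hx0, hx⟩ := hmem
  have hx' : T.adjMatrix ℝ *ᵥ x = (xiOne Tᶜ / 2) • x := by
    rw [Matrix.smul_mulVec] at hx
    rw [div_eq_inv_mul, mul_smul, ← hx, smul_smul]
    norm_num
  have h := hT.sq_le_of_mulVec_adjMatrix hx0 hx'
  rw [hV] at h
  refine Real.lt_sqrt_of_sq_lt (lt_of_le_of_lt ?_ (lt_largerRoot hn))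
  linarith

theorem SimpleGraph.IsDoubleStar.nonempty_iso_diamThreeTree {V : Type*} [Fintype V] [DecidableEq V]
    {n : ℕ} (hV : Fintype.card V = n) {T : SimpleGraph V} {s : V → Bool} {c : Bool → V}
    (h : T.IsDoubleStar s c) (hne : ∀ i, (sideLeaves s c i).Nonempty)
    (h1 : (sideLeaves s c true).card = 1) : Nonempty (T ≃g diamThreeTree 0 (n - 4)) := by
  refine h.nonempty_iso (diamThreeTree_isDoubleStar 0 (n - 4)) fun i => ?_
  rw [card_sideLeaves_diamThreeTree]
  have := h.card_eq
  have := (hne false).card_pos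
  cases i
  · simp only [cond_false]; omega
  · simp only [cond_true]; omega

theorem mainTheorem2 {V : Type*} [Fintype V] [DecidableEq V] (n : ℕ) (hn : 4 ≤ n)
    (hV : Fintype.card V = n) (T : SimpleGraph V) (hT : T.IsTree) (hTc : Tᶜ.Connected) :
    xiOne Tᶜ ≤ xiOne (diamThreeTree 0 (n - 4))ᶜ ∧
      (xiOne Tᶜ = xiOne (diamThreeTree 0 (n - 4))ᶜ ↔
        Nonempty (T ≃g diamThreeTree 0 (n - 4))) := by
  classical
  have hiso : Nonempty (T ≃g diamThreeTree 0 (n - 4)) →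
      xiOne Tᶜ = xiOne (diamThreeTree 0 (n - 4))ᶜ := by
    rintro ⟨e⟩
    have h := (diamThreeTree_isDoubleStar 0 (n - 4)).comap e
    rw [h.xiOne_compl (h.sideLeaves_nonempty hTc), xiOne_compl_diamThreeTree hn,
      card_sideLeaves_comap, card_sideLeaves_comap, card_sideLeaves_diamThreeTree,
      card_sideLeaves_diamThreeTree, hV]
    congr 2
    simp only [cond_true, cond_false]
    omega
  suffices h : xiOne Tᶜ < xiOne (diamThreeTree 0 (n - 4))ᶜ ∨
      Nonempty (T ≃g diamThreeTree 0 (n - 4)) by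
    rcases h with h | h
    · exact ⟨h.le, fun h' => absurd h' h.ne, hiso⟩
    · exact ⟨(hiso h).le, fun _ => h, hiso⟩
  by_cases hdom : ∀ u v, T.Adj u v → ∃ w, w ≠ u ∧ w ≠ v ∧ ¬ T.Adj u w ∧ ¬ T.Adj w v
  · left
    rw [xiOne_compl_diamThreeTree hn]
    exact xiOne_compl_lt_of_forall_adj hn hV hT hdom
  push Not at hdom
  obtain ⟨u, v, huv, hdom⟩ := hdom
  obtain ⟨s, c, h⟩ : ∃ s c, T.IsDoubleStar s c :=
    ⟨_, _, hT.isAcyclic.isDoubleStar huv fun w hu hv => or_iff_not_imp_left.2 (hdom w hu hv)⟩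
  have hne := h.sideLeaves_nonempty hTc
  have hx := h.xiOne_compl hne
  have hcard := h.card_eq
  have ht := (hne true).card_pos
  have hf := (hne false).card_pos
  rw [hV] at hx hcard
  by_cases h1 : (sideLeaves s c true).card = 1
  · exact Or.inr (h.nonempty_iso_diamThreeTree hV hne h1)
  by_cases h2 : (sideLeaves s c false).card = 1
  · refine Or.inr (h.swap.nonempty_iso_diamThreeTree hV (fun i => ?_) ?_)
    · rw [sideLeaves_swap]; exact hne _
    · rw [sideLeaves_swap]; exact h2
  left
  rw [xiOne_compl_diamThreeTree hn, hx]
  generalize (sideLeaves s c true).card = a at *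
  generalize (sideLeaves s c false).card = b at *
  have hlt : largerRoot n (a * b) < largerRoot n (n - 3) := by
    refine largerRoot_lt_largerRoot ?_ ?_
    · obtain ⟨a, rfl⟩ : ∃ a', a = a' + 2 := ⟨a - 2, by omega⟩
      obtain ⟨b, rfl⟩ : ∃ b', b = b' + 2 := ⟨b - 2, by omega⟩
      have : n - 3 = a + b + 3 := by omega
      rw [this]
      nlinarith [Nat.zero_le (a * b)]
    · rw [hcard, Nat.add_sub_cancel, ← mul_assoc]
      exact four_mul_le_pow_two_add a b
  refine Real.sqrt_lt_sqrt ?_ hlt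
  unfold largerRoot
  positivity
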